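/- Let $C$ be a set of 4 candidates and let $V$ be a finite set of voters, where each voter $v \in V$ has a preference $>_v$ that is a strict total order on $C$. The set $\{>_v : v \in V\}$ is called the profile of the voters. The profile is called $\ell_2$-Euclidean in $\mathbb{R}^2$ if there is a map $f : V \sqcup C \to \mathbb{R}^2$ such that for every $v \in V$ and all $a, b \in C$, $$a >_v b \;\Longrightarrow\; \|f(v) - f(a)\|_2 < \|f(v) - f(b)\|_2 .$$ Two profiles are called isomorphic if they contain the same set of preferences up to a bijective renaming of the candidates, and a subprofile of a profile is a subset of its set of preferences. Let $\mathcal{P}^*_1, \mathcal{P}^*_2, \mathcal{P}^*_3$ be the following profiles on $\{c_1, c_2, c_3, c_4\}$, each consisting of 18 preferences, where every column is a preference listed from the most preferred candidate (top) to the least preferred one (bottom), and where only the index $i$ of the candidate $c_i$ is written: $$ \mathcal{P}^*_1 = \begin{pmatrix} 1 & 1 & 1 & 2 & 2 & 2 & 2 & 2 & 2 & 3 & 3 & 3 & 4 & 4 & 4 & 4 & 4 & 4 \\ 2 & 2 & 4 & 1 & 1 & 3 & 3 & 4 & 4 & 2 & 2 & 4 & 1 & 1 & 2 & 2 & 3 &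 3 \\ 3 & 4 & 2 & 3 & 4 & 1 & 4 & 1 & 3 & 1 & 4 & 2 & 2 & 3 & 1 & 3 & 1 & 2 \\ 4 & 3 & 3 & 4 & 3 & 4 & 1 & 3 & 1 & 4 & 1 & 1 & 3 & 2 & 3 & 1 & 2 & 1 \end{pmatrix}, $$ $$ \mathcal{P}^*_2 = \begin{pmatrix} 1 & 1 & 1 & 1 & 1 & 1 & 2 & 2 & 3 & 3 & 3 & 3 & 3 & 3 & 4 & 4 & 4 & 4 \\ 2 & 2 & 3 & 3 & 4 & 4 & 1 & 3 & 1 & 1 & 2 & 2 & 4 & 4 & 1 & 1 & 3 & 3 \\ 3 & 4 & 2 & 4 & 2 & 3 & 3 & 1 & 2 & 4 & 1 & 4 & 1 & 2 & 2 & 3 & 1 & 2 \\ 4 & 3 & 4 & 2 & 3 & 2 & 4 & 4 & 4 & 2 & 4 & 1 & 2 & 1 & 3 & 2 & 2 & 1 \end{pmatrix}, $$ $$ \mathcal{P}^*_3 = \begin{pmatrix} 1 & 1 & 1 & 1 & 2 & 2 & 2 & 2 & 2 & 2 & 3 & 3 & 3 & 3 & 4 & 4 & 4 & 4 \\ 2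 & 2 & 3 & 4 & 1 & 1 & 3 & 3 & 4 & 4 & 1 & 2 & 2 & 4 & 1 & 2 & 2 & 3 \\ 3 & 4 & 2 & 2 & 3 & 4 & 1 & 4 & 1 & 3 & 2 & 1 & 4 & 2 & 2 & 1 & 3 & 2 \\ 4 & 3 & 4 & 3 & 4 & 3 & 4 & 1 & 3 & 1 & 4 & 4 & 1 & 1 & 3 & 3 & 1 & 1 \end{pmatrix}. $$ Then the profile is $\ell_2$-Euclidean in $\mathbb{R}^2$ if and only if it is isomorphic to a subprofile of $\mathcal{P}^*_1$, $\mathcal{P}^*_2$ or $\mathcal{P}^*_3$. -/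

import Mathlib

namespace EuclideanProfile

/-- A preference over the set `C` of candidates: a total ranking without ties, i.e. a strict total
order; `r.prefers a b` says that `a` is preferred to `b`. -/
@[ext]
structure Ranking (C : Type*) where
  prefers : C → C → Prop
  irrefl : ∀ a, ¬ prefers a a
  trans : ∀ a b c, prefers a b → prefers b c → prefers a c
  total : ∀ a b, a ≠ b → prefers a b ∨ prefers b a

/-- Renaming the candidates of a ranking along a bijection. -/
def Ranking.rename {C D : Type*} (σ : C ≃ D) (r : Ranking C) : Ranking D where
  prefers a b := r.prefers (σ.symm a) (σ.symm b)
  irrefl _ := r.irrefl _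
  trans _ _ _ := r.trans _ _ _
  total _ _ h := r.total _ _ fun e => h (σ.symm.injective e)

/-- A preference profile on the candidates `C`: the set of the preferences of the voters. -/
abbrev Profile (C : Type*) := Set (Ranking C)

/-- The profile of a family of voters, `pref v` being the preference of the voter `v`. -/
def profileOf {V C : Type*} (pref : V → Ranking C) : Profile C := Set.range pref

/-- `f` maps voters and candidates into the normed group `E` in such a way that each voter is
strictly closer to the candidates that she prefers. -/
def IsRepresentation {V C E : Type*} [NormedAddCommGroup E] (pref : V → Ranking C)
    (f : V ⊕ C → E) : Prop :=
  ∀ (v : V) (a b : C), (pref v).prefers a b →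
    ‖f (Sum.inl v) - f (Sum.inr a)‖ < ‖f (Sum.inl v) - f (Sum.inr b)‖

/-- Voters with preferences `pref` have a Euclidean representation in the normed group `E`. -/
def IsEuclideanIn (E : Type*) [NormedAddCommGroup E] {V C : Type*} (pref : V → Ranking C) : Prop :=
  ∃ f : V ⊕ C → E, IsRepresentation pref f

/-- Two profiles are isomorphic if they contain the same preferences up to a renaming of the
candidates. -/
def Isomorphic {C D : Type*} (P : Profile C) (Q : Profile D) : Prop :=
  ∃ σ : C ≃ D, Ranking.rename σ '' P = Q

/-- The profile written as a matrix: each column is one preference, with the most preferred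
candidate on top. -/
def ofColumns {m n : ℕ} {C : Type*} (M : Matrix (Fin m) (Fin n) C) : Profile C :=
  {r | ∃ j : Fin n, ∀ i k : Fin m, i < k → r.prefers (M i j) (M k j)}

abbrev c₁ : Fin 4 := 0
abbrev c₂ : Fin 4 := 1
abbrev c₃ : Fin 4 := 2
abbrev c₄ : Fin 4 := 3

def matrix₁ : Matrix (Fin 4) (Fin 18) (Fin 4) := !![
  c₁, c₁, c₁, c₂, c₂, c₂, c₂, c₂, c₂, c₃, c₃, c₃, c₄, c₄, c₄, c₄, c₄, c₄;
  c₂, c₂, c₄, c₁, c₁, c₃, c₃, c₄, c₄, c₂, c₂, c₄, c₁, c₁, c₂, c₂, c₃, c₃;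
  c₃, c₄, c₂, c₃, c₄, c₁, c₄, c₁, c₃, c₁, c₄, c₂, c₂, c₃, c₁, c₃, c₁, c₂;
  c₄, c₃, c₃, c₄, c₃, c₄, c₁, c₃, c₁, c₄, c₁, c₁, c₃, c₂, c₃, c₁, c₂, c₁]

def matrix₂ : Matrix (Fin 4) (Fin 18) (Fin 4) := !![
  c₁, c₁, c₁, c₁, c₁, c₁, c₂, c₂, c₃, c₃, c₃, c₃, c₃, c₃, c₄, c₄, c₄, c₄;
  c₂, c₂, c₃, c₃, c₄, c₄, c₁, c₃, c₁, c₁, c₂, c₂, c₄, c₄, c₁, c₁, c₃, c₃;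
  c₃, c₄, c₂, c₄, c₂, c₃, c₃, c₁, c₂, c₄, c₁, c₄, c₁, c₂, c₂, c₃, c₁, c₂;
  c₄, c₃, c₄, c₂, c₃, c₂, c₄, c₄, c₄, c₂, c₄, c₁, c₂, c₁, c₃, c₂, c₂, c₁]

def matrix₃ : Matrix (Fin 4) (Fin 18) (Fin 4) := !![
  c₁, c₁, c₁, c₁, c₂, c₂, c₂, c₂, c₂, c₂, c₃, c₃, c₃, c₃, c₄, c₄, c₄, c₄;
  c₂, c₂, c₃, c₄, c₁, c₁, c₃, c₃, c₄, c₄, c₁, c₂, c₂, c₄, c₁, c₂, c₂, c₃;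
  c₃, c₄, c₂, c₂, c₃, c₄, c₁, c₄, c₁, c₃, c₂, c₁, c₄, c₂, c₂, c₁, c₃, c₂;
  c₄, c₃, c₄, c₃, c₄, c₃, c₄, c₁, c₃, c₁, c₄, c₄, c₁, c₁, c₃, c₃, c₁, c₁]

/-- The three explicit profiles `𝒫*₁`, `𝒫*₂`, `𝒫*₃` with 18 preferences on `c₁, c₂, c₃, c₄`. -/
def P₁ : Profile (Fin 4) := ofColumns matrix₁

def P₂ : Profile (Fin 4) := ofColumns matrix₂

def P₃ : Profile (Fin 4) := ofColumns matrix₃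

end EuclideanProfile

/-!
Four points `p c` of the plane satisfy an affine dependence `∑ w c = 0`, `∑ w c • p c = 0` with
`w ≠ 0`. Along such a dependence the weighted sum `∑ w c * ‖x - p c‖ ^ 2` is the same number `K` for
every point `x` (`sum_mul_norm_sub_sq`), and after replacing `w` by `-w` one may take `0 ≤ K`.
If a voter ranks the candidates as `i, j, k, l`, summation by parts writes `K` as
`-w i * (D j - D i) + (w k + w l) * (D k - D j) + w l * (D l - D k)`, where `D` is the squared
distance to the voter and the three differences are positive. Hence no voter has a ranking with
`0 ≤ w i`, `w k + w l ≤ 0` and `w l ≤ 0` (`not_blocked_of_lt`).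

List the candidates by increasing weight. The last weight cannot be the only positive one, since the
sum evaluated at the last candidate would then be negative (`exists_pos_weight`). If only the first
weight is negative, that candidate is never ranked last. Otherwise two weights are negative and two
positive, and the sign of the sum of the extreme weights decides between two lists of six excluded
rankings. In each of the three cases the 18 remaining rankings are those of one of the three
matrices, up to renaming, which is a finite check.

Conversely, each matrix is realised by integer points (`isEuclideanIn_of_intPoints`), and a
subprofile uses some of the voters.
-/

namespace EuclideanProfile

open Finset

/-! ### Affine dependences and squared distances -/

theorem exists_affine_dependence {ι E : Type*} [Fintype ι] [AddCommGroup E] [Module ℝ E]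
    [FiniteDimensional ℝ E] (h : Module.finrank ℝ E + 1 < Fintype.card ι) (p : ι → E) :
    ∃ w : ι → ℝ, w ≠ 0 ∧ ∑ i, w i = 0 ∧ ∑ i, w i • p i = 0 := by
  let T : (ι → ℝ) →ₗ[ℝ] E × ℝ := Fintype.linearCombination ℝ fun i => (p i, (1 : ℝ))
  have hT : LinearMap.ker T ≠ ⊥ := LinearMap.ker_ne_bot_of_finrank_lt (by simpa using h)
  obtain ⟨w, hw, hw0⟩ := (Submodule.ne_bot_iff _).1 hT
  rw [LinearMap.mem_ker, Fintype.linearCombination_apply] at hw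
  refine ⟨w, hw0, ?_, ?_⟩
  · simpa [Prod.snd_sum] using congrArg Prod.snd hw
  · simpa [Prod.fst_sum] using congrArg Prod.fst hw

/-- Along an affine dependence, the quadratic and the linear term in `x` of the weighted sum of the
squared distances to `x` cancel. -/
theorem sum_mul_norm_sub_sq {ι E : Type*} [Fintype ι] [NormedAddCommGroup E]
    [InnerProductSpace ℝ E] {w : ι → ℝ} {p : ι → E} (h₀ : ∑ i, w i = 0)
    (h₁ : ∑ i, w i • p i = 0) (x : E) :
    ∑ i, w i * ‖x - p i‖ ^ 2 = ∑ i, w i * ‖p i‖ ^ 2 := by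
  have h : ∑ i, w i * inner ℝ x (p i) = 0 := by
    simpa [inner_sum, inner_smul_right] using congrArg (inner ℝ x) h₁
  calc ∑ i, w i * ‖x - p i‖ ^ 2
      = ∑ i, (w i * ‖x‖ ^ 2 - 2 * (w i * inner ℝ x (p i)) + w i * ‖p i‖ ^ 2) :=
        sum_congr rfl fun i _ => by rw [norm_sub_sq_real]; ring
    _ = ∑ i, w i * ‖p i‖ ^ 2 := by
        rw [sum_add_distrib, sum_sub_distrib, ← sum_mul, ← mul_sum, h₀, h]; simp

/-- Four points of the plane, listed by increasing weight in an affine dependence whose weighted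
sum of squared distances is nonnegative. -/
theorem exists_sorted_dependence {C E : Type*} [NormedAddCommGroup E] [InnerProductSpace ℝ E]
    (hE : Module.finrank ℝ E = 2) (hC : Nat.card C = 4) (p : C → E) :
    ∃ (e : Fin 4 ≃ C) (w : Fin 4 → ℝ), Monotone w ∧ w ≠ 0 ∧ ∑ i, w i = 0 ∧
      ∀ x, 0 ≤ ∑ i, w i * ‖x - p (e i)‖ ^ 2 := by
  have : FiniteDimensional ℝ E := FiniteDimensional.of_finrank_pos (by omega)
  have : Finite C := Nat.finite_of_card_ne_zero (by omega)
  let e₀ : Fin 4 ≃ C := (Finite.equivFinOfCardEq hC).symm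
  obtain ⟨w, hw, h₀, hK⟩ : ∃ w : Fin 4 → ℝ, w ≠ 0 ∧ ∑ i, w i = 0 ∧
      ∀ x, 0 ≤ ∑ i, w i * ‖x - p (e₀ i)‖ ^ 2 := by
    obtain ⟨w, hw, h₀, h₁⟩ := exists_affine_dependence (by simp [hE]) (p ∘ e₀)
    have hconst := sum_mul_norm_sub_sq h₀ h₁
    rcases le_total 0 (∑ i, w i * ‖(p ∘ e₀) i‖ ^ 2) with h | h
    · exact ⟨w, hw, h₀, fun x => (hconst x).symm ▸ h⟩
    · refine ⟨-w, neg_ne_zero.2 hw, by simp [h₀], fun x => ?_⟩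
      have := hconst x
      simp only [Pi.neg_apply, neg_mul, sum_neg_distrib, Function.comp_apply] at *
      linarith
  let τ := Tuple.sort w
  refine ⟨τ.trans e₀, w ∘ τ, Tuple.monotone_sort w, fun h => hw ?_, ?_, fun x => ?_⟩
  · funext i
    simpa using congrFun h (τ.symm i)
  · simpa [h₀] using Equiv.sum_comp τ w
  · exact (hK x).trans_eq (Equiv.sum_comp τ fun i => w i * ‖x - p (e₀ i)‖ ^ 2).symm

/-- Two weights are positive: otherwise the last point would be a convex combination of the other
points, and the weighted sum of squared distances to it would be negative. -/
theorem exists_pos_weight {E : Type*} [NormedAddCommGroup E] {q : Fin 4 → E}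
    (hq : Function.Injective q) {w : Fin 4 → ℝ} (hw : w ≠ 0) (h₀ : ∑ i, w i = 0)
    (hmono : Monotone w) (hK : 0 ≤ ∑ i, w i * ‖q 3 - q i‖ ^ 2) : 0 < w 2 := by
  by_contra! h2
  have h01 : w 0 ≤ w 1 := hmono (by decide)
  have h12 : w 1 ≤ w 2 := hmono (by decide)
  have hd : ∀ i, i ≠ 3 → 0 < ‖q 3 - q i‖ ^ 2 := fun i hi =>
    pow_pos (norm_pos_iff.2 (sub_ne_zero.2 fun h => hi (hq h).symm)) 2
  have hneg : w 0 < 0 := by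
    by_contra! h
    apply hw
    simp only [Fin.sum_univ_four] at h₀
    funext i
    fin_cases i <;> simp <;> linarith
  simp only [Fin.sum_univ_four, sub_self, norm_zero] at hK
  have a0 := mul_neg_of_neg_of_pos hneg (hd 0 (by decide))
  have a1 := mul_nonpos_of_nonpos_of_nonneg (h12.trans h2) (hd 1 (by decide)).le
  have a2 := mul_nonpos_of_nonpos_of_nonneg h2 (hd 2 (by decide)).le
  linarith

/-- The rankings that an affine dependence forbids: in the order `s`, summation by parts leaves
only nonpositive coefficients. -/
theorem not_blocked_of_lt {w D : Fin 4 → ℝ} (hw : w ≠ 0) (h₀ : ∑ i, w i = 0)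
    (hK : 0 ≤ ∑ i, w i * D i) (s : Equiv.Perm (Fin 4)) (hs : StrictMono (D ∘ s)) :
    ¬ (0 ≤ w (s 0) ∧ w (s 2) + w (s 3) ≤ 0 ∧ w (s 3) ≤ 0) := by
  rintro ⟨h1, h2, h3⟩
  rw [← Equiv.sum_comp s, Fin.sum_univ_four] at h₀ hK
  have d1 : D (s 0) < D (s 1) := hs (by decide : (0 : Fin 4) < 1)
  have d2 : D (s 1) < D (s 2) := hs (by decide : (1 : Fin 4) < 2)
  have d3 : D (s 2) < D (s 3) := hs (by decide : (2 : Fin 4) < 3)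
  have e1 : 0 ≤ w (s 0) * (D (s 1) - D (s 0)) := mul_nonneg h1 (by linarith)
  have e2 : (w (s 2) + w (s 3)) * (D (s 2) - D (s 1)) ≤ 0 :=
    mul_nonpos_of_nonpos_of_nonneg h2 (by linarith)
  have e3 : w (s 3) * (D (s 3) - D (s 2)) ≤ 0 := mul_nonpos_of_nonpos_of_nonneg h3 (by linarith)
  have hparts : w (s 0) * D (s 0) + w (s 1) * D (s 1) + w (s 2) * D (s 2) + w (s 3) * D (s 3)
      = -(w (s 0) * (D (s 1) - D (s 0))) + (w (s 2) + w (s 3)) * (D (s 2) - D (s 1))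
        + w (s 3) * (D (s 3) - D (s 2)) := by
    linear_combination D (s 1) * h₀
  rw [hparts] at hK
  have z1 : w (s 0) = 0 :=
    (mul_eq_zero.1 (by linarith : w (s 0) * (D (s 1) - D (s 0)) = 0)).resolve_right
      (by linarith)
  have z2 : w (s 2) + w (s 3) = 0 :=
    (mul_eq_zero.1 (by linarith : (w (s 2) + w (s 3)) * (D (s 2) - D (s 1)) = 0)).resolve_right
      (by linarith)
  have z3 : w (s 3) = 0 :=
    (mul_eq_zero.1 (by linarith : w (s 3) * (D (s 3) - D (s 2)) = 0)).resolve_right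
      (by linarith)
  apply hw
  funext i
  obtain ⟨k, rfl⟩ := s.surjective i
  fin_cases k <;> simp <;> linarith

/-! ### Rankings as permutations -/

/-- A ranking given by comparing real numbers lists the candidates by increasing value. -/
theorem Ranking.exists_listing {C : Type*} (r : Ranking C) {n : ℕ} (e : Fin n ≃ C) (D : C → ℝ)
    (hD : ∀ a b, r.prefers a b → D a < D b) :
    ∃ s : Equiv.Perm (Fin n), StrictMono ((D ∘ e) ∘ s) ∧
      ∀ i k, i < k → r.prefers (e (s i)) (e (s k)) := by
  have key : ∀ i k, i < k → r.prefers (e (Tuple.sort (D ∘ e) i)) (e (Tuple.sort (D ∘ e) k)) := by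
    intro i k hik
    refine (r.total _ _ fun h => hik.ne ?_).resolve_right fun h => ?_
    · exact (Tuple.sort (D ∘ e)).injective (e.injective h)
    · exact absurd (Tuple.monotone_sort (D ∘ e) hik.le) (not_le.2 (hD _ _ h))
  exact ⟨Tuple.sort (D ∘ e), fun i k hik => hD _ _ (key i k hik), key⟩

theorem Ranking.rename_mem_ofColumns {C : Type*} (r : Ranking C) {n : ℕ} (e : Fin 4 ≃ C)
    (π s : Equiv.Perm (Fin 4)) (hs : ∀ i k, i < k → r.prefers (e (s i)) (e (s k)))
    {M : Matrix (Fin 4) (Fin n) (Fin 4)} (h : ∃ j, ∀ i, M i j = π (s i)) :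
    Ranking.rename (e.symm.trans π) r ∈ ofColumns M := by
  obtain ⟨j, hj⟩ := h
  refine ⟨j, fun i k hik => ?_⟩
  simpa [Ranking.rename, hj] using hs i k hik

/-- The rankings in which the first candidate is not last are those of `matrix₃`. -/
theorem exists_column_matrix₃ (s : Equiv.Perm (Fin 4)) (h : s 3 ≠ 0) :
    ∃ j, ∀ i, matrix₃ i j = Equiv.swap (0 : Fin 4) 1 (s i) := by
  revert s
  decide

/-- For weights of signs `-, -, +, +` in which the first one has the largest absolute value, the
rankings that are not excluded are those of `matrix₁`. -/
theorem exists_column_matrix₁ (s : Equiv.Perm (Fin 4))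
    (h : ¬ (s 0 ∈ ({2, 3} : Finset (Fin 4)) ∧ (s 2 < 2 ∧ s 3 < 2 ∨
      2 ≤ s 2 ∧ s 3 = 0))) :
    ∃ j, ∀ i, matrix₁ i j = (![1, 3, 0, 2] : Fin 4 → Fin 4) (s i) := by
  revert s
  decide

/-- For weights of signs `-, -, +, +` in which the last one has the largest absolute value, the
rankings that are not excluded are those of `matrix₂`. -/
theorem exists_column_matrix₂ (s : Equiv.Perm (Fin 4))
    (h : ¬ (s 0 ∈ ({2, 3} : Finset (Fin 4)) ∧ (s 2 < 2 ∧ s 3 < 2 ∨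
      s 2 = 2 ∧ s 3 < 2))) :
    ∃ j, ∀ i, matrix₂ i j = (![0, 2, 3, 1] : Fin 4 → Fin 4) (s i) := by
  revert s
  decide

/-! ### Realising profiles by integer points -/

/-- A matrix realised by integer points: `cand c` is the position of the candidate `c`, and
`vot j` that of a voter whose ranking is the column `j`. Every subprofile of it is then
Euclidean. -/
theorem isEuclideanIn_of_intPoints {V C : Type*} {n : ℕ} (pref : V → Ranking C) (σ : C ≃ Fin 4)
    {M : Matrix (Fin 4) (Fin n) (Fin 4)} (cand : Fin 4 → ℤ × ℤ) (vot : Fin n → ℤ × ℤ)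
    (hsurj : ∀ j c, ∃ i, M i j = c)
    (hlt : ∀ j i k, i < k →
      ((vot j).1 - (cand (M i j)).1) ^ 2 + ((vot j).2 - (cand (M i j)).2) ^ 2 <
      ((vot j).1 - (cand (M k j)).1) ^ 2 + ((vot j).2 - (cand (M k j)).2) ^ 2)
    (hM : ∀ v, Ranking.rename σ (pref v) ∈ ofColumns M) :
    IsEuclideanIn (EuclideanSpace ℝ (Fin 2)) pref := by
  choose col hcol using hM
  let pt : ℤ × ℤ → EuclideanSpace ℝ (Fin 2) := fun z => !₂[(z.1 : ℝ), (z.2 : ℝ)]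
  have hpt : ∀ y z, ‖pt y - pt z‖ ^ 2 = (((y.1 - z.1) ^ 2 + (y.2 - z.2) ^ 2 : ℤ) : ℝ) := by
    intro y z
    simp [pt, EuclideanSpace.norm_sq_eq]
  refine ⟨Sum.elim (fun v => pt (vot (col v))) (fun c => pt (cand (σ c))), fun v a b hab => ?_⟩
  obtain ⟨i, hi⟩ := hsurj (col v) (σ a)
  obtain ⟨k, hk⟩ := hsurj (col v) (σ b)
  have hik : i < k := by
    by_contra! hki
    rcases hki.eq_or_lt with rfl | hki
    · exact (pref v).irrefl a (by simpa [σ.injective (hi.symm.trans hk)] using hab)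
    · have := hcol v k i hki
      rw [hi, hk] at this
      exact (pref v).irrefl a
        ((pref v).trans _ _ _ hab (by simpa [Ranking.rename] using this))
  have := hlt (col v) i k hik
  rw [hi, hk] at this
  refine lt_of_pow_lt_pow_left₀ 2 (norm_nonneg _) ?_
  simp only [Sum.elim_inl, Sum.elim_inr, hpt]
  exact_mod_cast this

theorem isEuclideanIn_of_rename_mem {V C : Type*} (pref : V → Ranking C) (σ : C ≃ Fin 4)
    (h : (∀ v, Ranking.rename σ (pref v) ∈ P₁) ∨ (∀ v, Ranking.rename σ (pref v) ∈ P₂) ∨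
      ∀ v, Ranking.rename σ (pref v) ∈ P₃) :
    IsEuclideanIn (EuclideanSpace ℝ (Fin 2)) pref := by
  rcases h with h | h | h
  · exact isEuclideanIn_of_intPoints pref σ ![(6, -3), (1, -3), (-6, 0), (0, 4)]
      ![(4, -18), (4, -8), (5, 2), (-4, -18), (1, -3), (-9, -18), (-3, -4), (0, -2), (-1, 0),
        (-18, -18), (-18, -17), (-18, -2), (4, 2), (4, 14), (1, 1), (-1, 1), (4, 15), (-13, 18)]
      (by decide) (by decide) h
  · exact isEuclideanIn_of_intPoints pref σ ![(6, 3), (7, 2), (2, -2), (-4, -3)]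
      ![(-4, 16), (-8, 21), (-2, 8), (-2, 6), (-11, 21), (-7, 14), (5, 0), (7, -3), (0, 3),
        (-1, 4), (3, -3), (5, -8), (-2, 4), (0, -8), (-12, 21), (-21, 21), (-21, -21), (-16, -21)]
      (by decide) (by decide) h
  · exact isEuclideanIn_of_intPoints pref σ ![(-4, 4), (0, -3), (-3, -4), (4, -4)]
      ![(-6, 11), (1, 3), (-12, -1), (5, 6), (-1, 1), (1, 2), (-2, -1), (-1, -4), (2, 1),
        (1, -7), (-12, -5), (-12, -11), (-11, -12), (0, -12), (7, 6), (4, 1), (1, -10), (1, -12)]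
      (by decide) (by decide) h

/-! ### Euclidean profiles are subprofiles of the three profiles -/

theorem exists_rename_mem_of_isEuclideanIn {V C E : Type*} [NormedAddCommGroup E]
    [InnerProductSpace ℝ E] (hE : Module.finrank ℝ E = 2) (hC : Nat.card C = 4)
    (pref : V → Ranking C) (h : IsEuclideanIn E pref) :
    ∃ σ : C ≃ Fin 4, (∀ v, Ranking.rename σ (pref v) ∈ P₁) ∨
      (∀ v, Ranking.rename σ (pref v) ∈ P₂) ∨ ∀ v, Ranking.rename σ (pref v) ∈ P₃ := by
  obtain ⟨f, hf⟩ := h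
  obtain ⟨e, w, hmono, hw, h₀, hK⟩ :=
    exists_sorted_dependence hE hC fun c => f (Sum.inr c)
  -- Without voters the candidates need not be at distinct points, but there is nothing to prove.
  rcases isEmpty_or_nonempty V with hV | ⟨⟨v₀⟩⟩
  · exact ⟨e.symm, Or.inl hV.elim⟩
  have hinj : Function.Injective fun i => f (Sum.inr (e i)) := by
    intro i k hik
    by_contra hne
    rcases (pref v₀).total (e i) (e k) (e.injective.ne hne) with h | h
    · exact (hf v₀ _ _ h).ne (by simp only at hik; rw [hik])
    · exact (hf v₀ _ _ h).ne (by simp only at hik; rw [hik])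
  have hpos : 0 < w 2 := exists_pos_weight hinj hw h₀ hmono (hK _)
  have hlist : ∀ v, ∃ s : Equiv.Perm (Fin 4),
      (∀ i k, i < k → (pref v).prefers (e (s i)) (e (s k))) ∧
      ¬ (0 ≤ w (s 0) ∧ w (s 2) + w (s 3) ≤ 0 ∧ w (s 3) ≤ 0) := by
    intro v
    obtain ⟨s, hs, hp⟩ := (pref v).exists_listing e
      (fun c => ‖f (Sum.inl v) - f (Sum.inr c)‖ ^ 2) fun a b hab =>
        pow_lt_pow_left₀ (hf v a b hab) (norm_nonneg _) two_ne_zero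
    exact ⟨s, hp, not_blocked_of_lt hw h₀ (hK (f (Sum.inl v))) s hs⟩
  choose s hp hs using hlist
  have h01 : w 0 ≤ w 1 := hmono (by decide)
  have h23 : w 2 ≤ w 3 := hmono (by decide)
  have hsum : w 0 + w 1 + w 2 + w 3 = 0 := by rwa [Fin.sum_univ_four] at h₀
  rcases le_or_gt 0 (w 1) with h1 | h1
  · refine ⟨e.symm.trans (Equiv.swap 0 1), Or.inr (Or.inr fun v => ?_)⟩
    refine (pref v).rename_mem_ofColumns e _ (s v) (hp v) (exists_column_matrix₃ _ fun h3 => hs v ?_)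
    have hnn : ∀ i, i ≠ 0 → 0 ≤ w i := fun i hi =>
      h1.trans (hmono (Fin.one_le_of_ne_zero hi))
    have hle : ∀ i, i ≠ 0 → w i + w 0 ≤ 0 := by
      intro i hi
      fin_cases i
      · exact absurd rfl hi
      all_goals simp; linarith
    have hne : ∀ i, i ≠ 3 → s v i ≠ 0 := fun i hi h => hi ((s v).injective (h.trans h3.symm))
    rw [h3]
    exact ⟨hnn _ (hne 0 (by decide)), hle _ (hne 2 (by decide)), by linarith⟩
  have hneg : ∀ i : Fin 4, i < 2 → w i < 0 := fun i hi =>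
    (hmono (Fin.le_def.2 (Nat.le_of_lt_succ hi) : i ≤ 1)).trans_lt h1
  have hfirst : ∀ i : Fin 4, i ∈ ({2, 3} : Finset (Fin 4)) → 0 ≤ w i := by
    intro i hi
    refine hpos.le.trans (hmono ?_)
    revert i
    decide
  rcases le_total (w 0 + w 3) 0 with h03 | h03
  · refine ⟨e.symm.trans (Equiv.ofBijective ![1, 3, 0, 2] (by decide)), Or.inl fun v => ?_⟩
    refine (pref v).rename_mem_ofColumns e _ (s v) (hp v) (exists_column_matrix₁ _ ?_)
    rintro ⟨hi, hkl⟩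
    refine hs v ⟨hfirst _ hi, ?_⟩
    rcases hkl with ⟨hk, hl⟩ | ⟨-, hl⟩
    · exact ⟨(add_neg (hneg _ hk) (hneg _ hl)).le, (hneg _ hl).le⟩
    · have := hmono (Fin.le_last (s v 2))
      simp only [hl]
      exact ⟨by change w _ ≤ w 3 at this; linarith, by linarith⟩
  · refine ⟨e.symm.trans (Equiv.ofBijective ![0, 2, 3, 1] (by decide)), Or.inr (Or.inl fun v => ?_)⟩
    refine (pref v).rename_mem_ofColumns e _ (s v) (hp v) (exists_column_matrix₂ _ ?_)
    rintro ⟨hi, hkl⟩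
    refine hs v ⟨hfirst _ hi, ?_⟩
    rcases hkl with ⟨hk, hl⟩ | ⟨hk, hl⟩
    · exact ⟨(add_neg (hneg _ hk) (hneg _ hl)).le, (hneg _ hl).le⟩
    · have := hmono (Fin.le_def.2 (Nat.le_of_lt_succ hl) : s v 3 ≤ 1)
      rw [hk]
      exact ⟨by linarith, by linarith⟩

end EuclideanProfile

/-- Voters `V` with preferences over 4 candidates `C` are Euclidean in `ℝ²` for the `ℓ₂` norm if and
only if their profile is isomorphic to a subprofile of one of three explicit profiles. -/
theorem mainTheorem2 {V C : Type*} [Finite V] (hC : Nat.card C = 4)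
    (pref : V → EuclideanProfile.Ranking C) :
    EuclideanProfile.IsEuclideanIn (EuclideanSpace ℝ (Fin 2)) pref ↔
      ∃ Q : EuclideanProfile.Profile (Fin 4),
        (Q ⊆ EuclideanProfile.P₁ ∨ Q ⊆ EuclideanProfile.P₂ ∨ Q ⊆ EuclideanProfile.P₃) ∧
          EuclideanProfile.Isomorphic (EuclideanProfile.profileOf pref) Q := by
  have hsub : ∀ (σ : C ≃ Fin 4) (P : EuclideanProfile.Profile (Fin 4)),
      EuclideanProfile.Ranking.rename σ '' EuclideanProfile.profileOf pref ⊆ P ↔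
        ∀ v, EuclideanProfile.Ranking.rename σ (pref v) ∈ P := fun σ P => by
    simp [EuclideanProfile.profileOf, Set.subset_def]
  constructor
  · intro h
    obtain ⟨σ, hσ⟩ := EuclideanProfile.exists_rename_mem_of_isEuclideanIn (by simp) hC pref h
    exact ⟨_, by simpa only [hsub] using hσ, σ, rfl⟩
  · rintro ⟨_, hQ, σ, rfl⟩
    exact EuclideanProfile.isEuclideanIn_of_rename_mem pref σ (by simpa only [hsub] using hQ)
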